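/- Consider a ring of $N$ processors, $N\ge 1$ odd, numbered clockwise modulo $N$; a configuration specifies which processors hold a token, and the initial configuration has an odd number of tokens. When a token is passed, it moves from its processor to the clockwise neighbour; whenever a processor keeps its token and receives another token, both of these tokens are annihilated. In the synchronous protocol with pass probability $r\in(0,1)$, in each discrete time step every token, independently of the others, is passed with probability $r$ and kept with probability $1-r$; put $D=r(1-r)$. In the asynchronous protocol with rate $\lambda>0$, the configuration evolves as a continuous-time Markov chain in which every token is passed with rate $\lambda$, independently of the others; put $D=\lambda$. Let $\mathbf{T}$ be the first time at which exactly one token is left. Then for both protocols, for every such $N$ and every initial configuration with an odd number of tokens, $$\mathbb{E}\,\mathbf{T}\;\le\;\left(\frac{\pi^2}{8}-1-\frac19+\frac1{27}\right)\cdot\frac{N^2}{D}.$$ In particular, $\mathbb{E}\,\mathbf{T}\le 0.64\,N^2$ for the synchronous protocol with $r=1/2$. -/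

import Mathlib

open scoped ENNReal NNReal Topology

namespace Herman

/-- A configuration of the token ring with `N` processors: the set of processors that hold a token.
Processors are numbered modulo `N` clockwise, so that the clockwise neighbour of `i` is `i + 1`. -/
abbrev Config (N : ℕ) := Finset (ZMod N)

/-- A configuration is legitimate if it has exactly one token. -/
def Legitimate {N : ℕ} (c : Config N) : Prop := c.card = 1

/-- The configuration reached from `c` when exactly the tokens at the processors in `S ⊆ c` are
passed to the clockwise neighbour. A processor that keeps its token and also receives one ends up
without token (both tokens are annihilated), whence the symmetric difference. -/
def pass {N : ℕ} (c S : Config N) : Config N :=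
  symmDiff (c \ S) (S.image (fun i => i + 1))

/-- Transition matrix of the synchronous protocol: in one time step every token of `c`,
independently of the others, is passed with probability `r` and kept with probability `1 - r`.
The sum is over the set `S` of the processors that pass their token. -/
noncomputable def syncMatrix (N : ℕ) (r : ℝ) : Matrix (Config N) (Config N) ℝ :=
  fun c c' => ∑ S ∈ c.powerset,
    r ^ S.card * (1 - r) ^ (c.card - S.card) * (if pass c S = c' then 1 else 0)

/-- Generator (rate matrix) of the asynchronous protocol: every token of `c` is passed
to the clockwise neighbour with rate `lam`, independently of the others. -/
noncomputable def asyncGenerator (N : ℕ) (lam : ℝ) : Matrix (Config N) (Config N) ℝ :=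
  fun c c' => ∑ i ∈ c,
    lam * ((if pass c {i} = c' then 1 else 0) - (if c = c' then 1 else 0))

/-- `X` is a discrete-time Markov chain with transition matrix `P` and initial state `x₀`. -/
structure IsMarkovChain {Ω S : Type*} [MeasurableSpace Ω] [DecidableEq S] (μ : MeasureTheory.Measure Ω)
    (P : Matrix S S ℝ) (x₀ : S) (X : ℕ → Ω → S) : Prop where
  measurable : ∀ n x, MeasurableSet {ω | X n ω = x}
  law : ∀ (n : ℕ) (x : ℕ → S), μ.real {ω | ∀ k ≤ n, X k ω = x k} =
    (if x 0 = x₀ then 1 else 0) * ∏ k ∈ Finset.range n, P (x k) (x (k + 1))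

/-- `X` is a continuous-time Markov chain on the finite state space `S` with generator `Q` and
initial state `x₀`: its paths are right-continuous (for the discrete topology on `S`), and its
finite-dimensional distributions are those given by the transition semigroup `t ↦ exp (t Q)`. -/
structure IsContinuousTimeMarkovChain {Ω S : Type*} [MeasurableSpace Ω] [Fintype S] [DecidableEq S]
    (μ : MeasureTheory.Measure Ω) (Q : Matrix S S ℝ) (x₀ : S) (X : ℝ≥0 → Ω → S) : Prop where
  measurable : ∀ t x, MeasurableSet {ω | X t ω = x}
  right_continuous : ∀ ω t, ∀ᶠ s in 𝓝[≥] t, X s ω = X t ω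
  law : ∀ (n : ℕ) (t : ℕ → ℝ≥0) (x : ℕ → S), Monotone t → t 0 = 0 →
    μ.real {ω | ∀ k ≤ n, X (t k) ω = x k} = (if x 0 = x₀ then 1 else 0) *
      ∏ k ∈ Finset.range n, NormedSpace.exp (((t (k + 1) : ℝ) - (t k : ℝ)) • Q) (x k) (x (k + 1))

/-- `X` is a run of the synchronous protocol with pass probability `r`, started in `c₀`. -/
def IsSyncRun {N : ℕ} {Ω : Type*} [MeasurableSpace Ω] (μ : MeasureTheory.Measure Ω)
    (r : ℝ) (c₀ : Config N) (X : ℕ → Ω → Config N) : Prop :=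
  IsMarkovChain μ (syncMatrix N r) c₀ X

/-- `X` is a run of the asynchronous protocol with pass rate `lam`, started in `c₀`. -/
def IsAsyncRun {N : ℕ} [NeZero N] {Ω : Type*} [MeasurableSpace Ω] (μ : MeasureTheory.Measure Ω)
    (lam : ℝ) (c₀ : Config N) (X : ℝ≥0 → Ω → Config N) : Prop :=
  IsContinuousTimeMarkovChain μ (asyncGenerator N lam) c₀ X

/-- The stabilization time of a run in discrete time (`∞` if no legitimate configuration is
ever reached). -/
noncomputable def syncTime {N : ℕ} {Ω : Type*} (X : ℕ → Ω → Config N) (ω : Ω) : ℝ≥0∞ :=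
  ⨅ (n : ℕ) (_ : Legitimate (X n ω)), (n : ℝ≥0∞)

/-- The stabilization time of a run in continuous time (`∞` if no legitimate configuration is
ever reached). -/
noncomputable def asyncTime {N : ℕ} {Ω : Type*} (X : ℝ≥0 → Ω → Config N) (ω : Ω) : ℝ≥0∞ :=
  ⨅ (t : ℝ≥0) (_ : Legitimate (X t ω)), (t : ℝ≥0∞)

end Herman

/-! Give every arc of `d` consecutive processors the sign (-1)^(number of its tokens). A round of
passing changes this sign only through the two processors where a token can enter or leave the arc
(`arcSign_pass`). Hence a_d, the sum of the signs of all arcs of length `d` (`arcSum`), satisfies in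
expectation a discrete heat equation in `d` for 0 < d < N: its drift is D (a_{d+1} + a_{d-1} - 2
a_d), in both protocols (`syncMatrix_mulVec_arcSum`, `asyncGenerator_mulVec_arcSum`).

The weights N - 2d of `potential` are linear in `d`, so summation by parts leaves only a_0, a_1,
a_{N-1}, a_N, and these depend only on the number k of tokens (`sum_weight_mul_second_difference`).
For odd k the drift of `potential` is 4DN(k - 1), which is at least 8DN until a single token is
left.

Since |`potential`| ≤ N^3/2, a Foster-Lyapunov argument in discrete or continuous time bounds the
expected time by 2 (N^3/2) / (8DN) = N^2/(8D), and 1/8 is below the claimed constant. -/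

namespace Herman

/-! ### Arc signs, their behaviour under passing, and the potential. -/

section Spin

variable {N : ℕ}

/-- The spin of processor `y`: `-1` if it holds a token, `1` otherwise. -/
noncomputable def spin (c : Config N) (y : ZMod N) : ℝ := if y ∈ c then -1 else 1

/-- The parity sign of the number of tokens at the `d` processors that follow `x`. -/
noncomputable def arcSign (c : Config N) (x : ZMod N) (d : ℕ) : ℝ :=
  ∏ k ∈ Finset.range d, spin c (x + (k : ZMod N) + 1)

lemma spin_mul_self (c : Config N) (y : ZMod N) : spin c y * spin c y = 1 := by
  unfold spin; split_ifs <;> norm_num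

lemma abs_spin (c : Config N) (y : ZMod N) : |spin c y| = 1 := by
  unfold spin; split_ifs <;> norm_num

lemma abs_arcSign (c : Config N) (x : ZMod N) (d : ℕ) : |arcSign c x d| = 1 := by
  unfold arcSign
  rw [Finset.abs_prod]
  exact Finset.prod_eq_one fun _ _ => abs_spin _ _

lemma spin_symmDiff (a b : Config N) (y : ZMod N) :
    spin (symmDiff a b) y = spin a y * spin b y := by
  unfold spin
  by_cases ha : y ∈ a <;> by_cases hb : y ∈ b <;> simp [Finset.mem_symmDiff, ha, hb]

lemma spin_image_add_one (S : Config N) (y : ZMod N) :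
    spin (S.image (fun i => i + 1)) (y + 1) = spin S y := by
  unfold spin
  simp

lemma spin_pass {c S : Config N} (hS : S ⊆ c) (y : ZMod N) :
    spin (pass c S) (y + 1) = spin c (y + 1) * spin S (y + 1) * spin S y := by
  rw [pass, spin_symmDiff, spin_image_add_one]
  congr 1
  have hc : symmDiff c S = c \ S := by
    rw [symmDiff_comm]; exact symmDiff_of_le hS
  rw [← hc, spin_symmDiff]

lemma arcSign_zero (c : Config N) (x : ZMod N) : arcSign c x 0 = 1 := by simp [arcSign]

lemma arcSign_succ (c : Config N) (x : ZMod N) (d : ℕ) :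
    arcSign c x (d + 1) = arcSign c x d * spin c (x + ((d + 1 : ℕ) : ZMod N)) := by
  rw [arcSign, Finset.prod_range_succ, ← arcSign]
  push_cast
  rw [add_assoc]

lemma arcSign_succ' (c : Config N) (x : ZMod N) (d : ℕ) :
    arcSign c (x - 1) (d + 1) = spin c x * arcSign c x d := by
  rw [arcSign, Finset.prod_range_succ', mul_comm, arcSign]
  congr 1
  · simp
  · refine Finset.prod_congr rfl fun k _ => ?_
    congr 1
    push_cast
    ring

/-- Passing tokens changes the parity on an arc only through its two boundary processors. -/
lemma arcSign_pass {c S : Config N} (hS : S ⊆ c) (x : ZMod N) (d : ℕ) :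
    arcSign (pass c S) x d =
      arcSign c x d * (spin S x * spin S (x + (d : ZMod N))) := by
  induction d with
  | zero => simp [arcSign_zero, spin_mul_self]
  | succ d ih =>
    have h := spin_pass hS (x + (d : ZMod N))
    have hx : x + (d : ZMod N) + 1 = x + ((d + 1 : ℕ) : ZMod N) := by push_cast; ring
    rw [hx] at h
    rw [arcSign_succ, arcSign_succ, ih, h]
    linear_combination (arcSign c x d * spin S x * spin c (x + ((d + 1 : ℕ) : ZMod N)) *
      spin S (x + ((d + 1 : ℕ) : ZMod N))) * spin_mul_self S (x + (d : ZMod N))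

lemma prod_ite_eq_spin (S : Config N) (x : ZMod N) :
    ∏ i ∈ S, (if i = x then (-1 : ℝ) else 1) = spin S x := by
  rw [Finset.prod_ite_eq']
  rfl

lemma arcSign_succ_mul_spin (c : Config N) (x : ZMod N) (d : ℕ) :
    arcSign c x (d + 1) * spin c (x + ((d + 1 : ℕ) : ZMod N)) = arcSign c x d := by
  rw [arcSign_succ, mul_assoc, spin_mul_self, mul_one]

lemma add_natCast_ne {d : ℕ} (hd : 0 < d) (hdN : d < N) (x : ZMod N) :
    x ≠ x + (d : ZMod N) := by
  intro h
  have h0 : (d : ZMod N) = 0 := by simpa using h.symm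
  rw [ZMod.natCast_eq_zero_iff] at h0
  exact absurd (Nat.le_of_dvd hd h0) (by omega)

lemma sum_powerset_weight (r : ℝ) (c : Config N) :
    ∑ S ∈ c.powerset, r ^ S.card * (1 - r) ^ (c.card - S.card) = 1 := by
  rw [Finset.sum_pow_mul_eq_add_pow]
  simp

/-- The tokens decide independently, so the expectation factors over them. At distinct `x` and `y`
the two signs are independent; for `x = y` their product would be 1 instead. -/
lemma sum_powerset_spin_mul_spin (r : ℝ) (c : Config N) {x y : ZMod N} (hxy : x ≠ y) :
    ∑ S ∈ c.powerset, r ^ S.card * (1 - r) ^ (c.card - S.card) * (spin S x * spin S y) =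
      (1 - r + r * spin c x) * (1 - r + r * spin c y) := by
  have hs : ∀ z, 1 - r + r * spin c z = ∏ i ∈ c, (if i = z then 1 - 2 * r else 1) := by
    intro z
    rw [Finset.prod_ite_eq', spin]
    split_ifs <;> ring
  -- Each token's factor is written as (passed) + (kept), so that expanding the product gives the
  -- sum over the set `S` of passed tokens.
  rw [hs, hs, ← Finset.prod_mul_distrib]
  have hf : ∀ i ∈ c, (if i = x then 1 - 2 * r else 1) * (if i = y then 1 - 2 * r else 1) =
      r * ((if i = x then (-1 : ℝ) else 1) * (if i = y then (-1 : ℝ) else 1)) + (1 - r) := by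
    intro i _
    by_cases h1 : i = x
    · have h2 : i ≠ y := fun h => hxy (h1.symm.trans h)
      simp only [h1, if_true, if_neg hxy]; ring
    · by_cases h2 : i = y
      · simp only [h2, if_true, if_neg (Ne.symm hxy)]; ring
      · simp only [h1, h2, if_false]; ring
  rw [Finset.prod_congr rfl hf, Finset.prod_add]
  refine Finset.sum_congr rfl fun S hS => ?_
  rw [Finset.prod_mul_distrib, Finset.prod_mul_distrib, prod_ite_eq_spin, prod_ite_eq_spin,
    Finset.prod_const, Finset.prod_const, Finset.card_sdiff_of_subset (Finset.mem_powerset.1 hS)]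
  ring

variable [NeZero N]

/-- The parity sign of the number of all tokens. -/
noncomputable def sign (c : Config N) : ℝ := (-1) ^ c.card

lemma arcSign_full (c : Config N) (x : ZMod N) : arcSign c x N = sign c := by
  have h1 : ∏ y : ZMod N, spin c y = sign c := by
    unfold spin sign
    rw [Finset.prod_ite]
    simp
  rw [← h1, arcSign]
  refine Finset.prod_bij (fun k _ => x + (k : ZMod N) + 1) (fun _ _ => Finset.mem_univ _) ?_ ?_
    (fun _ _ => rfl)
  · intro a ha b hb hab
    have h : (a : ZMod N) = b := by simpa using hab
    rw [ZMod.natCast_eq_natCast_iff'] at h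
    rwa [Nat.mod_eq_of_lt (Finset.mem_range.1 ha), Nat.mod_eq_of_lt (Finset.mem_range.1 hb)] at h
  · intro b _
    refine ⟨(b - 1 - x).val, Finset.mem_range.2 (ZMod.val_lt _), ?_⟩
    rw [ZMod.natCast_zmod_val]
    ring

lemma sign_pass {c S : Config N} (hS : S ⊆ c) : sign (pass c S) = sign c := by
  rw [← arcSign_full _ 0, ← arcSign_full _ 0, arcSign_pass hS]
  simp [spin_mul_self]

/-- The sum of the parity signs over all arcs of length `d`. -/
noncomputable def arcSum (c : Config N) (d : ℕ) : ℝ := ∑ x, arcSign c x d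

lemma arcSum_zero (c : Config N) : arcSum c 0 = N := by
  simp [arcSum, arcSign_zero, ZMod.card]

lemma arcSum_full (c : Config N) : arcSum c N = sign c * N := by
  simp [arcSum, arcSign_full, ZMod.card, mul_comm]

lemma arcSum_one (c : Config N) : arcSum c 1 = N - 2 * c.card := by
  have h : ∀ x, arcSign c (x - 1) 1 = 1 - 2 * (if x ∈ c then 1 else 0) := by
    intro x
    rw [(arcSign_succ' c x 0 : arcSign c (x - 1) 1 = _), arcSign_zero, spin]
    split_ifs <;> norm_num
  rw [arcSum, ← (Equiv.subRight (1 : ZMod N)).sum_comp]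
  simp only [Equiv.subRight_apply, h]
  rw [Finset.sum_sub_distrib, ← Finset.mul_sum]
  simp [ZMod.card]

lemma sum_arcSign_sub_one (c : Config N) (d : ℕ) :
    ∑ x, arcSign c (x - 1) d = arcSum c d := by
  exact (Equiv.subRight (1 : ZMod N)).sum_comp fun x => arcSign c x d

lemma sum_spin_mul_arcSign (c : Config N) (d : ℕ) :
    ∑ x, spin c x * arcSign c x d = arcSum c (d + 1) := by
  rw [← sum_arcSign_sub_one]
  exact Finset.sum_congr rfl fun x _ => (arcSign_succ' c x d).symm

/-- The complement of an arc of length N - 1 is one processor, and complementary arcs have signs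
with product `sign c`. -/
lemma arcSum_pred (c : Config N) : arcSum c (N - 1) = sign c * arcSum c 1 := by
  obtain ⟨n, rfl⟩ := Nat.exists_eq_succ_of_ne_zero (NeZero.ne N)
  have h : ∀ x, arcSign c x n = sign c * spin c x := by
    intro x
    rw [← arcSign_succ_mul_spin, arcSign_full]
    simp
  rw [Nat.succ_sub_one, ← sum_spin_mul_arcSign, arcSum, Finset.mul_sum]
  exact Finset.sum_congr rfl fun x _ => by rw [h, arcSign_zero, mul_one]

lemma abs_arcSum_le (c : Config N) (d : ℕ) : |arcSum c d| ≤ N := by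
  refine (Finset.abs_sum_le_sum_abs _ _).trans ?_
  simp [abs_arcSign, ZMod.card]

/-- The potential of a configuration: the parity signs of all arcs, an arc of length `d` being
weighted by `N - 2 * d`. -/
noncomputable def potential (c : Config N) : ℝ :=
  ∑ j ∈ Finset.range (N - 1), ((N : ℝ) - 2 * (j + 1)) * arcSum c (j + 1)

/-- Summation by parts: a linear weight has zero second difference, so no interior term survives. -/
lemma sum_linear_mul_second_difference (a : ℝ) (f : ℕ → ℝ) (n : ℕ) :
    ∑ j ∈ Finset.range n, (a - 2 * (j + 1)) * (f (j + 2) + f j - 2 * f (j + 1)) =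
      (a - 2 * n) * f (n + 1) - (a - 2 * (n + 1)) * f n - a * f 1 + (a - 2) * f 0 := by
  induction n with
  | zero => simp
  | succ n ih =>
    rw [Finset.sum_range_succ, ih]
    push_cast
    ring

lemma sum_weight_mul_second_difference (c : Config N) :
    ∑ j ∈ Finset.range (N - 1), ((N : ℝ) - 2 * (j + 1)) *
        (arcSum c (j + 2) + arcSum c j - 2 * arcSum c (j + 1)) =
      2 * N * (1 - sign c) * (c.card - 1) := by
  have hN : N - 1 + 1 = N := Nat.succ_pred_eq_of_ne_zero (NeZero.ne N)
  have hc : ((N - 1 : ℕ) : ℝ) = N - 1 := by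
    rw [Nat.cast_sub (NeZero.one_le), Nat.cast_one]
  rw [sum_linear_mul_second_difference, hN, arcSum_full, arcSum_pred, arcSum_one, arcSum_zero, hc]
  ring

lemma sum_abs_weight_le (hN : Odd N) :
    ∑ j ∈ Finset.range (N - 1), |(N : ℝ) - 2 * (j + 1)| ≤ (N : ℝ) ^ 2 / 2 := by
  obtain ⟨m, rfl⟩ := hN
  rw [Nat.add_sub_cancel, two_mul, Finset.sum_range_add, ← Finset.sum_add_distrib]
  -- With N = 2m + 1, the weights at `j` and `m + j` have absolute values 2m - 1 - 2j and 2j + 1;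
  -- the full sum is 2m² = (N - 1)²/2.
  have h : ∀ j ∈ Finset.range m,
      |((m + m + 1 : ℕ) : ℝ) - 2 * ((j : ℝ) + 1)| +
        |((m + m + 1 : ℕ) : ℝ) - 2 * (((m + j : ℕ) : ℝ) + 1)| = 2 * m := by
    intro j hj
    have hj' : (j : ℝ) + 1 ≤ m := by exact_mod_cast Finset.mem_range.1 hj
    have hj0 : (0 : ℝ) ≤ j := Nat.cast_nonneg j
    push_cast
    rw [abs_of_nonneg (by linarith), abs_of_nonpos (by linarith)]
    ring
  rw [Finset.sum_congr rfl h]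
  push_cast
  simp only [Finset.sum_const, Finset.card_range, nsmul_eq_mul]
  have hm : (0 : ℝ) ≤ m := Nat.cast_nonneg m
  nlinarith

lemma abs_potential_le (hN : Odd N) (c : Config N) : |potential c| ≤ (N : ℝ) ^ 3 / 2 := by
  calc |potential c|
      ≤ ∑ j ∈ Finset.range (N - 1), |(N : ℝ) - 2 * (j + 1)| * N := by
        refine (Finset.abs_sum_le_sum_abs _ _).trans (Finset.sum_le_sum fun j _ => ?_)
        rw [abs_mul]
        exact mul_le_mul_of_nonneg_left (abs_arcSum_le _ _) (abs_nonneg _)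
    _ ≤ (N : ℝ) ^ 2 / 2 * N := by
        rw [← Finset.sum_mul]
        exact mul_le_mul_of_nonneg_right (sum_abs_weight_le hN) (Nat.cast_nonneg N)
    _ = (N : ℝ) ^ 3 / 2 := by ring

end Spin

/-! ### Drift of the potential under both protocols. -/

section Drift

open Matrix

variable {N : ℕ} [NeZero N]

lemma syncMatrix_mulVec (r : ℝ) (f : Config N → ℝ) (c : Config N) :
    (syncMatrix N r *ᵥ f) c =
      ∑ S ∈ c.powerset, r ^ S.card * (1 - r) ^ (c.card - S.card) * f (pass c S) := by
  simp only [mulVec, dotProduct, syncMatrix, Finset.sum_mul]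
  rw [Finset.sum_comm]
  refine Finset.sum_congr rfl fun S _ => ?_
  simp [mul_assoc]

lemma asyncGenerator_mulVec (lam : ℝ) (f : Config N → ℝ) (c : Config N) :
    (asyncGenerator N lam *ᵥ f) c = ∑ i ∈ c, lam * (f (pass c {i}) - f c) := by
  simp only [mulVec, dotProduct, asyncGenerator, Finset.sum_mul]
  rw [Finset.sum_comm]
  refine Finset.sum_congr rfl fun S _ => ?_
  simp [mul_assoc, ← Finset.mul_sum, sub_mul, Finset.sum_sub_distrib]

/-- Multiplying by the spin at `x` extends the arc backwards by one processor, and multiplying by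
the spin of its last processor removes that one. The four terms therefore describe an arc whose two
ends each step back independently with probability `r`. The bound `hj` keeps the two boundary
processors distinct. -/
lemma syncMatrix_mulVec_arcSign (r : ℝ) (c : Config N) {j : ℕ} (hj : j + 1 < N) (x : ZMod N) :
    (syncMatrix N r *ᵥ fun c => arcSign c x (j + 1)) c =
      (1 - r) ^ 2 * arcSign c x (j + 1) + r ^ 2 * (arcSign c (x - 1) (j + 1)) +
        r * (1 - r) * (spin c x * arcSign c x (j + 1) + arcSign c x j) := by
  rw [syncMatrix_mulVec]
  have h : ∀ S ∈ c.powerset, r ^ S.card * (1 - r) ^ (c.card - S.card) *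
      arcSign (pass c S) x (j + 1) = arcSign c x (j + 1) * (r ^ S.card *
        (1 - r) ^ (c.card - S.card) * (spin S x * spin S (x + ((j + 1 : ℕ) : ZMod N)))) := by
    intro S hS
    rw [arcSign_pass (Finset.mem_powerset.1 hS)]
    ring
  rw [Finset.sum_congr rfl h, ← Finset.mul_sum,
    sum_powerset_spin_mul_spin r c (add_natCast_ne (Nat.succ_pos j) hj x), arcSign_succ' c x j]
  linear_combination (r * (1 - r) + r ^ 2 * spin c x) * arcSign_succ_mul_spin c x j

lemma syncMatrix_mulVec_arcSum (r : ℝ) (c : Config N) {j : ℕ} (hj : j + 1 < N) :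
    (syncMatrix N r *ᵥ fun c => arcSum c (j + 1)) c = arcSum c (j + 1) +
      r * (1 - r) * (arcSum c (j + 2) + arcSum c j - 2 * arcSum c (j + 1)) := by
  have h : (syncMatrix N r *ᵥ fun c => arcSum c (j + 1)) c =
      ∑ x, (syncMatrix N r *ᵥ fun c => arcSign c x (j + 1)) c := by
    simp only [mulVec, dotProduct, arcSum, Finset.mul_sum]
    exact Finset.sum_comm
  rw [h, Finset.sum_congr rfl fun x _ => syncMatrix_mulVec_arcSign r c hj x]
  simp only [Finset.sum_add_distrib, ← Finset.mul_sum]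
  rw [sum_arcSign_sub_one, sum_spin_mul_arcSign, ← arcSum, ← arcSum]
  ring

lemma mulVec_potential (A : Matrix (Config N) (Config N) ℝ) (c : Config N) :
    (A *ᵥ potential) c = ∑ j ∈ Finset.range (N - 1), ((N : ℝ) - 2 * (j + 1)) *
      (A *ᵥ fun c => arcSum c (j + 1)) c := by
  simp only [mulVec, dotProduct, potential, Finset.mul_sum]
  rw [Finset.sum_comm]
  exact Finset.sum_congr rfl fun j _ => Finset.sum_congr rfl fun c' _ => by ring

lemma syncMatrix_mulVec_potential (r : ℝ) (c : Config N) :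
    (syncMatrix N r *ᵥ potential) c =
      potential c + r * (1 - r) * (2 * N * (1 - sign c) * (c.card - 1)) := by
  rw [mulVec_potential, ← sum_weight_mul_second_difference, potential, Finset.mul_sum,
    ← Finset.sum_add_distrib]
  refine Finset.sum_congr rfl fun j hj => ?_
  rw [syncMatrix_mulVec_arcSum r c (by have := Finset.mem_range.1 hj; omega)]
  ring

lemma syncMatrix_mulVec_one_add_sign (r a : ℝ) :
    (syncMatrix N r *ᵥ fun c => a * (1 + sign c)) = fun c => a * (1 + sign c) := by
  funext c
  rw [syncMatrix_mulVec, Finset.sum_congr rfl fun S hS => by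
    rw [sign_pass (Finset.mem_powerset.1 hS)], ← Finset.sum_mul, sum_powerset_weight, one_mul]

/-- Only a token at one of the two boundary processors matters; passing it flips the sign, hence the
factors -2. -/
lemma asyncGenerator_mulVec_arcSign (lam : ℝ) (c : Config N) {j : ℕ} (hj : j + 1 < N)
    (x : ZMod N) :
    (asyncGenerator N lam *ᵥ fun c => arcSign c x (j + 1)) c =
      lam * (spin c x * arcSign c x (j + 1) + arcSign c x j - 2 * arcSign c x (j + 1)) := by
  have hxy := add_natCast_ne (Nat.succ_pos j) hj x
  rw [asyncGenerator_mulVec]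
  have hs : ∀ z, spin c z - 1 = ∑ i ∈ c, (if i = z then (-2 : ℝ) else 0) := by
    intro z
    rw [Finset.sum_ite_eq', spin]
    split_ifs <;> ring
  have h : ∀ i ∈ c, lam * (arcSign (pass c {i}) x (j + 1) - arcSign c x (j + 1)) =
      lam * arcSign c x (j + 1) * ((if i = x then (-2 : ℝ) else 0) +
        (if i = x + ((j + 1 : ℕ) : ZMod N) then (-2 : ℝ) else 0)) := by
    intro i hi
    rw [arcSign_pass (Finset.singleton_subset_iff.2 hi)]
    generalize x + ((j + 1 : ℕ) : ZMod N) = y at hxy ⊢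
    unfold spin
    simp only [Finset.mem_singleton, eq_comm (b := i)]
    by_cases h1 : i = x
    · simp only [h1, if_true, if_neg hxy]; ring
    · by_cases h2 : i = y
      · simp only [h2, if_true, if_neg (Ne.symm hxy)]; ring
      · simp only [h1, h2, if_false]; ring
  rw [Finset.sum_congr rfl h, ← Finset.mul_sum, Finset.sum_add_distrib, ← hs, ← hs]
  linear_combination lam * arcSign_succ_mul_spin c x j

lemma asyncGenerator_mulVec_arcSum (lam : ℝ) (c : Config N) {j : ℕ} (hj : j + 1 < N) :
    (asyncGenerator N lam *ᵥ fun c => arcSum c (j + 1)) c =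
      lam * (arcSum c (j + 2) + arcSum c j - 2 * arcSum c (j + 1)) := by
  have h : (asyncGenerator N lam *ᵥ fun c => arcSum c (j + 1)) c =
      ∑ x, (asyncGenerator N lam *ᵥ fun c => arcSign c x (j + 1)) c := by
    simp only [mulVec, dotProduct, arcSum, Finset.mul_sum]
    exact Finset.sum_comm
  rw [h, Finset.sum_congr rfl fun x _ => asyncGenerator_mulVec_arcSign lam c hj x,
    ← Finset.mul_sum, Finset.sum_sub_distrib, Finset.sum_add_distrib, ← Finset.mul_sum,
    sum_spin_mul_arcSign, ← arcSum, ← arcSum]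

lemma asyncGenerator_mulVec_potential (lam : ℝ) (c : Config N) :
    (asyncGenerator N lam *ᵥ potential) c = lam * (2 * N * (1 - sign c) * (c.card - 1)) := by
  rw [mulVec_potential, ← sum_weight_mul_second_difference, Finset.mul_sum]
  refine Finset.sum_congr rfl fun j hj => ?_
  rw [asyncGenerator_mulVec_arcSum lam c (by have := Finset.mem_range.1 hj; omega)]
  ring

lemma asyncGenerator_mulVec_one_add_sign (lam a : ℝ) :
    (asyncGenerator N lam *ᵥ fun c => a * (1 + sign c)) = 0 := by
  funext c
  rw [asyncGenerator_mulVec, Pi.zero_apply]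
  refine Finset.sum_eq_zero fun i hi => ?_
  rw [sign_pass (Finset.singleton_subset_iff.2 hi), sub_self, mul_zero]

/-- For an even number of tokens the potential has no drift. The term with `1 + sign c` then
supplies exactly 8DN; it is conserved by the dynamics and vanishes for odd configurations, so it
costs nothing from an odd start. -/
lemma drift_lower_bound {D : ℝ} (hD : 0 < D) (c : Config N) :
    {c : Config N | Legitimate c}ᶜ.indicator (fun _ => 8 * D * N) c ≤
      D * (2 * N * (1 - sign c) * (c.card - 1)) + 4 * D * N * (1 + sign c) := by
  have hDN : 0 < D * N := mul_pos hD (Nat.cast_pos.2 (NeZero.pos N))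
  rw [sign]
  by_cases h : c.card = 1
  · rw [Set.indicator_of_notMem (by simpa [Legitimate] using h)]
    simp [h]
  rw [Set.indicator_of_mem (by simpa [Legitimate] using h)]
  rcases Nat.even_or_odd c.card with he | ho
  · rw [he.neg_one_pow]
    nlinarith
  · rw [ho.neg_one_pow]
    have h3 : (3 : ℝ) ≤ c.card := by
      obtain ⟨k, hk⟩ := ho
      exact_mod_cast (by lia : 3 ≤ c.card)
    nlinarith

end Drift

/-! ### Expectations of functions of a finite-valued random variable. -/

section FiniteState

open MeasureTheory Matrix

variable {Ω S : Type*} [MeasurableSpace Ω] {μ : Measure Ω}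

lemma measurableSet_preimage_of_fibers [Finite S] {Y : Ω → S}
    (hY : ∀ y, MeasurableSet {ω | Y ω = y}) (A : Set S) : MeasurableSet {ω | Y ω ∈ A} := by
  have h : {ω | Y ω ∈ A} = ⋃ y ∈ A, {ω | Y ω = y} := by
    ext ω
    simp
  rw [h]
  exact MeasurableSet.biUnion (Set.toFinite A).countable fun y _ => hY y

variable [Fintype S]

lemma measureReal_eq_sum_fibers [IsFiniteMeasure μ] {Y : Ω → S}
    (hY : ∀ y, MeasurableSet {ω | Y ω = y}) {E : Set Ω} (hE : MeasurableSet E) :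
    μ.real E = ∑ y, μ.real (E ∩ {ω | Y ω = y}) := by
  have h : E = ⋃ y ∈ (Finset.univ : Finset S), (E ∩ {ω | Y ω = y}) := by
    ext ω
    simp
  conv_lhs => rw [h]
  refine measureReal_biUnion_finset (fun a _ b _ hab => ?_) fun y _ => hE.inter (hY y)
  refine Set.disjoint_left.2 fun ω ha hb => hab ?_
  exact ha.2.symm.trans hb.2

/-- The expectation of `f (Y ω)`, as a finite sum over the state space. -/
noncomputable def expect (μ : Measure Ω) (Y : Ω → S) (f : S → ℝ) : ℝ :=
  ∑ y, μ.real {ω | Y ω = y} * f y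

lemma expect_mono {Y : Ω → S} {f g : S → ℝ} (h : ∀ y, f y ≤ g y) :
    expect μ Y f ≤ expect μ Y g :=
  Finset.sum_le_sum fun y _ => mul_le_mul_of_nonneg_left (h y) measureReal_nonneg

lemma expect_add (Y : Ω → S) (f g : S → ℝ) :
    expect μ Y (f + g) = expect μ Y f + expect μ Y g := by
  simp [expect, mul_add, Finset.sum_add_distrib]

lemma expect_sub (Y : Ω → S) (f g : S → ℝ) :
    expect μ Y (f - g) = expect μ Y f - expect μ Y g := by
  simp [expect, mul_sub, Finset.sum_sub_distrib]

lemma abs_expect_le [IsProbabilityMeasure μ] {Y : Ω → S}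
    (hY : ∀ y, MeasurableSet {ω | Y ω = y}) {f : S → ℝ} {R : ℝ} (hf : ∀ y, |f y| ≤ R) :
    |expect μ Y f| ≤ R := by
  have h1 : ∑ y, μ.real {ω | Y ω = y} = 1 := by
    have h := measureReal_eq_sum_fibers (μ := μ) hY MeasurableSet.univ
    simpa using h.symm
  calc |expect μ Y f| ≤ ∑ y, μ.real {ω | Y ω = y} * R := by
        refine (Finset.abs_sum_le_sum_abs _ _).trans (Finset.sum_le_sum fun y _ => ?_)
        rw [abs_mul, abs_of_nonneg measureReal_nonneg]
        exact mul_le_mul_of_nonneg_left (hf y) measureReal_nonneg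
    _ = R := by rw [← Finset.sum_mul, h1, one_mul]

lemma expect_indicator [IsFiniteMeasure μ] {Y : Ω → S}
    (hY : ∀ y, MeasurableSet {ω | Y ω = y}) (A : Set S) (a : ℝ) :
    expect μ Y (A.indicator fun _ => a) = μ.real {ω | Y ω ∈ A} * a := by
  rw [measureReal_eq_sum_fibers hY (measurableSet_preimage_of_fibers hY A), expect,
    Finset.sum_mul]
  refine Finset.sum_congr rfl fun y _ => ?_
  by_cases hy : y ∈ A
  · rw [Set.indicator_of_mem hy]
    congr 2
    ext ω
    constructor
    · rintro rfl
      exact ⟨hy, rfl⟩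
    · exact fun h => h.2
  · rw [Set.indicator_of_notMem hy, mul_zero]
    have h : {ω | Y ω ∈ A} ∩ {ω | Y ω = y} = ∅ := by
      ext ω
      simp only [Set.mem_inter_iff, Set.mem_ofPred_eq, Set.mem_empty_iff_false, iff_false]
      rintro ⟨h1, rfl⟩
      exact hy h1
    rw [h, measureReal_empty, zero_mul]

end FiniteState

/-! ### Foster-Lyapunov bound for discrete-time chains. -/

section DiscreteTime

open MeasureTheory Matrix

variable {Ω S : Type*} [MeasurableSpace Ω] [Fintype S] [DecidableEq S] {μ : Measure Ω}
  {P : Matrix S S ℝ} {x₀ : S} {X : ℕ → Ω → S}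

lemma IsMarkovChain.expect_zero (hX : IsMarkovChain μ P x₀ X) (f : S → ℝ) :
    expect μ (X 0) f = f x₀ := by
  have h : ∀ a, μ.real {ω | X 0 ω = a} = if a = x₀ then 1 else 0 := by
    intro a
    have h := hX.law 0 fun _ => a
    simpa using h
  simp [expect, h]

variable [IsProbabilityMeasure μ]

/-- The law is given on whole paths, so both sides are summed over the possible pasts before time
`n`. -/
lemma IsMarkovChain.measureReal_inter (hX : IsMarkovChain μ P x₀ X) (n : ℕ) (a b : S) :
    μ.real ({ω | X n ω = a} ∩ {ω | X (n + 1) ω = b}) = μ.real {ω | X n ω = a} * P a b := by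
  have hY : ∀ p : Fin n → S, MeasurableSet {ω | (fun i : Fin n => X i ω) = p} := by
    intro p
    simp only [funext_iff, Set.ofPred_forall]
    exact MeasurableSet.iInter fun i => hX.measurable i (p i)
  rw [measureReal_eq_sum_fibers hY ((hX.measurable n a).inter (hX.measurable (n + 1) b)),
    measureReal_eq_sum_fibers hY (hX.measurable n a), Finset.sum_mul]
  refine Finset.sum_congr rfl fun p _ => ?_
  set x : ℕ → S := fun k => if h : k < n then p ⟨k, h⟩ else if k = n then a else b with hx
  have hxlt : ∀ i : Fin n, x i = p i := fun i => by simp [hx]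
  have hxn : x n = a := by simp [hx]
  have hxs : x (n + 1) = b := by simp [hx]
  have h1 : {ω | X n ω = a} ∩ {ω | (fun i : Fin n => X i ω) = p} =
      {ω | ∀ k ≤ n, X k ω = x k} := by
    ext ω
    simp only [Set.mem_inter_iff, Set.mem_ofPred_eq, funext_iff]
    constructor
    · rintro ⟨ha, hp⟩ k hk
      rcases hk.lt_or_eq with hk | rfl
      · rw [← Fin.val_mk hk, hxlt]
        exact hp _
      · rw [hxn, ha]
    · intro h
      exact ⟨(h n le_rfl).trans hxn, fun i => (h i i.2.le).trans (hxlt i)⟩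
  have h2 : {ω | X n ω = a} ∩ {ω | X (n + 1) ω = b} ∩ {ω | (fun i : Fin n => X i ω) = p} =
      {ω | ∀ k ≤ n + 1, X k ω = x k} := by
    rw [Set.inter_right_comm, h1]
    ext ω
    simp only [Set.mem_inter_iff, Set.mem_ofPred_eq]
    constructor
    · rintro ⟨h, hb⟩ k hk
      rcases hk.lt_or_eq with hk | rfl
      · exact h k (Nat.lt_succ_iff.1 hk)
      · rw [hxs, hb]
    · intro h
      exact ⟨fun k hk => h k (hk.trans (Nat.le_succ n)), (h (n + 1) le_rfl).trans hxs⟩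
  rw [h1, h2, hX.law, hX.law, Finset.prod_range_succ, hxn, hxs, mul_assoc]

lemma IsMarkovChain.expect_succ (hX : IsMarkovChain μ P x₀ X) (n : ℕ) (f : S → ℝ) :
    expect μ (X (n + 1)) f = expect μ (X n) (P *ᵥ f) := by
  have h : ∀ b, μ.real {ω | X (n + 1) ω = b} = ∑ a, μ.real {ω | X n ω = a} * P a b := by
    intro b
    rw [measureReal_eq_sum_fibers (hX.measurable n) (hX.measurable (n + 1) b)]
    refine Finset.sum_congr rfl fun a _ => ?_
    rw [Set.inter_comm, hX.measureReal_inter]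
  simp only [expect, h, mulVec, dotProduct, Finset.sum_mul, Finset.mul_sum, mul_assoc]
  exact Finset.sum_comm

lemma IsMarkovChain.expect_eq_of_invariant (hX : IsMarkovChain μ P x₀ X) {e : S → ℝ}
    (he : P *ᵥ e = e) (n : ℕ) : expect μ (X n) e = e x₀ := by
  induction n with
  | zero => exact hX.expect_zero e
  | succ n ih => rw [hX.expect_succ, he, ih]

/-- A Foster-Lyapunov bound for the hitting time of `A`: outside `A` the potential `h` grows by at
least `ε` per step on average, up to an invariant function `e` that vanishes at the start. -/
theorem IsMarkovChain.lintegral_hittingTime_le (hX : IsMarkovChain μ P x₀ X) (A : Set S)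
    {h e : S → ℝ} {ε R : ℝ} (hε : 0 < ε) (hR : ∀ y, |h y| ≤ R) (he : P *ᵥ e = e)
    (he₀ : e x₀ = 0)
    (hdrift : ∀ y, Aᶜ.indicator (fun _ => ε) y ≤ (P *ᵥ h) y - h y + e y) :
    Measurable (fun ω => ⨅ (n : ℕ) (_ : X n ω ∈ A), (n : ℝ≥0∞)) ∧
      ∫⁻ ω, (⨅ (n : ℕ) (_ : X n ω ∈ A), (n : ℝ≥0∞)) ∂μ ≤ ENNReal.ofReal (2 * R / ε) := by
  classical
  have hmeas : ∀ n, MeasurableSet {ω | X n ω ∈ A} := fun n =>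
    measurableSet_preimage_of_fibers (hX.measurable n) A
  have hmeas' : ∀ n, MeasurableSet {ω | X n ω ∈ Aᶜ} := fun n => (hmeas n).compl
  constructor
  · refine Measurable.iInf fun n => ?_
    have h1 : (fun ω => ⨅ _ : X n ω ∈ A, (n : ℝ≥0∞)) =
        fun ω => if X n ω ∈ A then (n : ℝ≥0∞) else ⊤ := by
      funext ω
      split_ifs with hω <;> simp [hω]
    rw [h1]
    exact Measurable.ite (hmeas n) measurable_const measurable_const
  have hstep : ∀ n, μ.real {ω | X n ω ∈ Aᶜ} * ε ≤
      expect μ (X (n + 1)) h - expect μ (X n) h := by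
    intro n
    -- The added 0 is `e x₀`, which by invariance is the expectation of `e` at time `n`; this makes
    -- `hdrift` applicable pointwise.
    rw [← expect_indicator (hX.measurable n), hX.expect_succ, ← expect_sub, ← add_zero
      (expect μ (X n) (P *ᵥ h - h)), ← he₀, ← hX.expect_eq_of_invariant he n, ← expect_add]
    exact expect_mono hdrift
  have hsum : ∀ n, ∑ k ∈ Finset.range n, μ.real {ω | X k ω ∈ Aᶜ} ≤ 2 * R / ε := by
    intro n
    rw [le_div_iff₀ hε, Finset.sum_mul]
    refine (Finset.sum_le_sum fun k _ => hstep k).trans ?_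
    rw [Finset.sum_range_sub fun k => expect μ (X k) h]
    have h1 := abs_le.1 (abs_expect_le (μ := μ) (hX.measurable n) hR)
    have h2 := abs_le.1 (abs_expect_le (μ := μ) (hX.measurable 0) hR)
    linarith [h1.2, h2.1]
  -- The hitting time is at most the total number of steps spent outside `A`, which is infinite if
  -- `A` is never hit.
  have hle : ∀ ω, (⨅ (n : ℕ) (_ : X n ω ∈ A), (n : ℝ≥0∞)) ≤
      ∑' n, {ω | X n ω ∈ Aᶜ}.indicator (fun _ => (1 : ℝ≥0∞)) ω := by
    intro ω
    by_cases hex : ∃ n, X n ω ∈ A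
    · refine (iInf₂_le (Nat.find hex) (Nat.find_spec hex)).trans ?_
      refine le_trans ?_ (ENNReal.sum_le_tsum (Finset.range (Nat.find hex)))
      rw [Finset.sum_congr rfl fun k hk => Set.indicator_of_mem
        (show ω ∈ {ω | X k ω ∈ Aᶜ} from Nat.find_min hex (Finset.mem_range.1 hk)) _]
      simp
    · have h1 : ∀ n, {ω | X n ω ∈ Aᶜ}.indicator (fun _ => (1 : ℝ≥0∞)) ω = 1 := fun n =>
        Set.indicator_of_mem (show ω ∈ {ω | X n ω ∈ Aᶜ} from fun hn => hex ⟨n, hn⟩) _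
      simp only [h1]
      rw [ENNReal.tsum_const_eq_top_of_ne_zero one_ne_zero]
      exact le_top
  calc ∫⁻ ω, (⨅ (n : ℕ) (_ : X n ω ∈ A), (n : ℝ≥0∞)) ∂μ
      ≤ ∫⁻ ω, ∑' n, {ω | X n ω ∈ Aᶜ}.indicator (fun _ => (1 : ℝ≥0∞)) ω ∂μ := lintegral_mono hle
    _ = ∑' n, μ {ω | X n ω ∈ Aᶜ} := by
        rw [lintegral_tsum fun n => (measurable_const.indicator (hmeas' n)).aemeasurable]
        refine tsum_congr fun n => ?_
        exact lintegral_indicator_one (hmeas' n)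
    _ ≤ ENNReal.ofReal (2 * R / ε) := by
        refine ENNReal.summable.tsum_le_of_sum_range_le fun n => ?_
        rw [Finset.sum_congr rfl fun k _ => (ofReal_measureReal (μ := μ)).symm,
          ← ENNReal.ofReal_sum_of_nonneg fun k _ => measureReal_nonneg]
        exact ENNReal.ofReal_le_ofReal (hsum n)

end DiscreteTime

/-! ### Foster-Lyapunov bound for continuous-time chains. -/

section ContinuousTime

open MeasureTheory Matrix

lemma hasDerivAt_exp_smul_mulVec {S : Type*} [Fintype S] [DecidableEq S] (Q : Matrix S S ℝ)
    (f : S → ℝ) (x : S) (t : ℝ) :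
    HasDerivAt (fun t : ℝ => (NormedSpace.exp (t • Q) *ᵥ f) x)
      ((NormedSpace.exp (t • Q) *ᵥ (Q *ᵥ f)) x) t := by
  let _ : NormedRing (Matrix S S ℝ) := Matrix.linftyOpNormedRing
  let _ : NormedAlgebra ℝ (Matrix S S ℝ) := Matrix.linftyOpNormedAlgebra
  have h : HasDerivAt (fun t : ℝ => NormedSpace.exp (t • Q)) (NormedSpace.exp (t • Q) * Q) t :=
    hasDerivAt_exp_smul_const Q t
  have hlin : ∀ M : Matrix S S ℝ, (M *ᵥ f) x =
      (LinearMap.toContinuousLinearMap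
        ((LinearMap.proj x).comp ((Matrix.mulVecBilin ℝ ℝ).flip f)) :
          Matrix S S ℝ →L[ℝ] ℝ) M := fun _ => rfl
  rw [mulVec_mulVec]
  simp only [hlin]
  exact (ContinuousLinearMap.hasFDerivAt _).comp_hasDerivAt t h

lemma continuous_exp_smul_mulVec {S : Type*} [Fintype S] [DecidableEq S] (Q : Matrix S S ℝ)
    (f : S → ℝ) (x : S) : Continuous fun t : ℝ => (NormedSpace.exp (t • Q) *ᵥ f) x :=
  continuous_iff_continuousAt.2 fun t => (hasDerivAt_exp_smul_mulVec Q f x t).continuousAt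

lemma exp_smul_mulVec_of_mulVec_eq_zero {S : Type*} [Fintype S] [DecidableEq S]
    {Q : Matrix S S ℝ} {e : S → ℝ} (he : Q *ᵥ e = 0) (x : S) (t : ℝ) :
    (NormedSpace.exp (t • Q) *ᵥ e) x = e x := by
  have h : ∀ s, HasDerivAt (fun t : ℝ => (NormedSpace.exp (t • Q) *ᵥ e) x) 0 s := by
    intro s
    simpa [he] using hasDerivAt_exp_smul_mulVec Q e x s
  have h1 := is_const_of_deriv_eq_zero (fun s => (h s).differentiableAt) (fun s => (h s).deriv) t 0
  simpa using h1

/-- By right-continuity a state taken at `t` persists on some interval [t, u), which contains points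
of the dense sequence arbitrarily close to `t`. The countable infimum gives measurability. -/
lemma hittingTime_eq_iInf_denseSeq {Ω S : Type*} {X : ℝ≥0 → Ω → S}
    (hX : ∀ ω t, ∀ᶠ s in 𝓝[≥] t, X s ω = X t ω) (A : Set S) (ω : Ω) :
    (⨅ (t : ℝ≥0) (_ : X t ω ∈ A), (t : ℝ≥0∞)) =
      ⨅ (n : ℕ) (_ : X (TopologicalSpace.denseSeq ℝ≥0 n) ω ∈ A),
        (TopologicalSpace.denseSeq ℝ≥0 n : ℝ≥0∞) := by
  refine le_antisymm (le_iInf₂ fun n hn =>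
    iInf₂_le (TopologicalSpace.denseSeq ℝ≥0 n) hn) (le_iInf₂ fun t ht => ?_)
  refine ENNReal.le_of_forall_pos_le_add fun ε hε _ => ?_
  have hlt : t < t + ε := lt_add_of_pos_right t hε
  obtain ⟨u, hu, hut⟩ := (mem_nhdsGE_iff_exists_Ico_subset' hlt).1 (hX ω t)
  obtain ⟨n, hq1, hq2⟩ := (TopologicalSpace.denseRange_denseSeq ℝ≥0).exists_mem_open
    isOpen_Ioo (Set.nonempty_Ioo.2 (lt_min hu hlt))
  have hXn : X (TopologicalSpace.denseSeq ℝ≥0 n) ω = X t ω :=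
    hut ⟨hq1.le, hq2.trans_le (min_le_left _ _)⟩
  refine (iInf₂_le n (by rwa [hXn])).trans ?_
  exact_mod_cast (hq2.trans_le (min_le_right _ _)).le

variable {Ω S : Type*} [MeasurableSpace Ω] [Fintype S] [DecidableEq S] {μ : Measure Ω}
  {Q : Matrix S S ℝ} {x₀ : S} {X : ℝ≥0 → Ω → S}

theorem IsContinuousTimeMarkovChain.measurable_hittingTime
    (hX : IsContinuousTimeMarkovChain μ Q x₀ X) (A : Set S) :
    Measurable (fun ω => ⨅ (t : ℝ≥0) (_ : X t ω ∈ A), (t : ℝ≥0∞)) := by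
  classical
  simp only [hittingTime_eq_iInf_denseSeq hX.right_continuous]
  refine Measurable.iInf fun n => ?_
  have h1 : (fun ω => ⨅ _ : X (TopologicalSpace.denseSeq ℝ≥0 n) ω ∈ A,
      (TopologicalSpace.denseSeq ℝ≥0 n : ℝ≥0∞)) =
      fun ω => if X (TopologicalSpace.denseSeq ℝ≥0 n) ω ∈ A then
      (TopologicalSpace.denseSeq ℝ≥0 n : ℝ≥0∞) else ⊤ := by
    funext ω
    split_ifs with hω <;> simp [hω]
  rw [h1]
  exact Measurable.ite (measurableSet_preimage_of_fibers (hX.measurable _) A)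
    measurable_const measurable_const

variable [IsProbabilityMeasure μ]

lemma IsContinuousTimeMarkovChain.expect_eq (hX : IsContinuousTimeMarkovChain μ Q x₀ X)
    (t : ℝ≥0) (f : S → ℝ) :
    expect μ (X t) f = (NormedSpace.exp ((t : ℝ) • Q) *ᵥ f) x₀ := by
  have h : ∀ y, μ.real {ω | X t ω = y} = NormedSpace.exp ((t : ℝ) • Q) x₀ y := by
    intro y
    rw [measureReal_eq_sum_fibers (hX.measurable 0) (hX.measurable t y)]
    have h1 : ∀ a, μ.real ({ω | X t ω = y} ∩ {ω | X 0 ω = a}) =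
        if a = x₀ then NormedSpace.exp ((t : ℝ) • Q) a y else 0 := by
      intro a
      have h2 := hX.law 1 (fun k => if k = 0 then 0 else t) (fun k => if k = 0 then a else y)
        (monotone_nat_of_le_succ fun k => by by_cases hk : k = 0 <;> simp [hk]) rfl
      have h3 : {ω | X t ω = y} ∩ {ω | X 0 ω = a} = {ω | ∀ k ≤ 1,
          X (if k = 0 then 0 else t) ω = if k = 0 then a else y} := by
        ext ω
        simp [Nat.le_one_iff_eq_zero_or_eq_one, and_comm]
      rw [h3, h2]
      simp
    simp [h1]
  simp [expect, h, mulVec, dotProduct]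

/-- A Foster-Lyapunov bound for the hitting time of `A`: outside `A` the potential `h` grows at
rate at least `ε` on average, up to an invariant function `e` that vanishes at the start. -/
theorem IsContinuousTimeMarkovChain.lintegral_hittingTime_le
    (hX : IsContinuousTimeMarkovChain μ Q x₀ X) (A : Set S)
    {h e : S → ℝ} {ε R : ℝ} (hε : 0 < ε) (hR : ∀ y, |h y| ≤ R) (he : Q *ᵥ e = 0)
    (he₀ : e x₀ = 0) (hdrift : ∀ y, Aᶜ.indicator (fun _ => ε) y ≤ (Q *ᵥ h) y + e y) :
    ∫⁻ ω, (⨅ (t : ℝ≥0) (_ : X t ω ∈ A), (t : ℝ≥0∞)) ∂μ ≤ ENNReal.ofReal (2 * R / ε) := by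
  have hT := hX.measurable_hittingTime A
  set T : Ω → ℝ≥0∞ := fun ω => ⨅ (t : ℝ≥0) (_ : X t ω ∈ A), (t : ℝ≥0∞) 
  change ∫⁻ ω, T ω ∂μ ≤ _
  set g' : ℝ → ℝ := fun t => (NormedSpace.exp (t • Q) *ᵥ (Q *ᵥ h)) x₀
  -- Here `g'` is the derivative of the expectation of `h` at time `t`, so its integral is at most
  -- 2R.
  have hrate : ∀ t : ℝ≥0, μ.real {ω | X t ω ∈ Aᶜ} ≤ g' t / ε := by
    intro t
    rw [le_div_iff₀ hε, ← expect_indicator (hX.measurable t)]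
    change _ ≤ (NormedSpace.exp ((t : ℝ) • Q) *ᵥ (Q *ᵥ h)) x₀
    rw [← hX.expect_eq, ← add_zero (expect μ (X t) (Q *ᵥ h)), ← he₀,
      ← exp_smul_mulVec_of_mulVec_eq_zero he x₀ t, ← hX.expect_eq, ← expect_add]
    exact expect_mono hdrift
  have hcont : Continuous g' := continuous_exp_smul_mulVec Q _ x₀
  have hint : ∀ K : ℝ≥0, ∫ t in (0 : ℝ)..K, g' t / ε ≤ 2 * R / ε := by
    intro K
    rw [intervalIntegral.integral_div, intervalIntegral.integral_eq_sub_of_hasDerivAt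
      (fun t _ => hasDerivAt_exp_smul_mulVec Q h x₀ t) (hcont.intervalIntegrable _ _),
      ← hX.expect_eq, ← NNReal.coe_zero, ← hX.expect_eq]
    have h1 := abs_le.1 (abs_expect_le (μ := μ) (hX.measurable K) hR)
    have h2 := abs_le.1 (abs_expect_le (μ := μ) (hX.measurable 0) hR)
    gcongr
    linarith [h1.2, h2.1]
  -- Layer-cake formula: t < T forces `X t` to lie outside `A`. Truncation at `K` confines the
  -- integral to (0, K], where `hint` applies; monotone convergence then removes it.
  have htrunc : ∀ K : ℕ, ∫⁻ ω, min (T ω) K ∂μ ≤ ENNReal.ofReal (2 * R / ε) := by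
    intro K
    have hfin : ∀ ω, min (T ω) K ≠ ⊤ := fun ω =>
      ne_top_of_le_ne_top (ENNReal.natCast_ne_top K) (min_le_right _ _)
    have hm : Measurable fun ω => (min (T ω) K).toReal := (hT.min measurable_const).ennreal_toReal
    calc ∫⁻ ω, min (T ω) K ∂μ = ∫⁻ ω, ENNReal.ofReal (min (T ω) K).toReal ∂μ :=
          lintegral_congr fun ω => (ENNReal.ofReal_toReal (hfin ω)).symm
      _ = ∫⁻ t in Set.Ioi (0 : ℝ), μ {ω | t < (min (T ω) K).toReal} :=
          lintegral_eq_lintegral_meas_lt μ (Filter.Eventually.of_forall fun ω =>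
            ENNReal.toReal_nonneg) hm.aemeasurable
      _ ≤ ∫⁻ t in Set.Ioi (0 : ℝ),
            (Set.Ioc (0 : ℝ) K).indicator (fun t => ENNReal.ofReal (g' t / ε)) t := by
          refine setLIntegral_mono' measurableSet_Ioi fun t ht => ?_
          by_cases htK : t ≤ K
          · rw [Set.indicator_of_mem (show t ∈ Set.Ioc (0 : ℝ) K from ⟨ht, htK⟩)]
            lift t to ℝ≥0 using le_of_lt ht
            refine le_trans ?_ (ENNReal.ofReal_le_ofReal (hrate t))
            rw [ofReal_measureReal]
            refine measure_mono fun ω hω hA => ?_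
            have h1 : (t : ℝ≥0∞) < min (T ω) K := by
              rw [← ENNReal.ofReal_coe_nnreal]
              exact (ENNReal.ofReal_lt_iff_lt_toReal t.2 (hfin ω)).2 hω
            exact absurd (h1.trans_le ((min_le_left _ _).trans (iInf₂_le t hA))) (lt_irrefl _)
          · have h1 : {ω | t < (min (T ω) K).toReal} = ∅ := by
              refine Set.eq_empty_of_forall_notMem fun ω hω => htK (le_of_lt (lt_of_lt_of_le hω ?_))
              exact ENNReal.toReal_le_of_le_ofReal (Nat.cast_nonneg K)
                (by rw [ENNReal.ofReal_natCast]; exact min_le_right _ _)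
            rw [h1, measure_empty]
            exact zero_le
      _ ≤ ∫⁻ t in Set.Ioc (0 : ℝ) K, ENNReal.ofReal (g' t / ε) := by
          rw [← lintegral_indicator measurableSet_Ioc]
          exact setLIntegral_le_lintegral _ _
      _ = ENNReal.ofReal (∫ t in Set.Ioc (0 : ℝ) K, g' t / ε) := by
          refine (ofReal_integral_eq_lintegral_ofReal ?_ ?_).symm
          · exact ((hcont.div_const ε).integrableOn_Icc).mono_set Set.Ioc_subset_Icc_self
          · filter_upwards [ae_restrict_mem measurableSet_Ioc] with t ht
            exact measureReal_nonneg.trans (hrate ⟨t, ht.1.le⟩)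
      _ ≤ ENNReal.ofReal (2 * R / ε) := by
          rw [← intervalIntegral.integral_of_le (Nat.cast_nonneg K)]
          exact ENNReal.ofReal_le_ofReal (by simpa using hint K)
  have hsup : ∀ ω, T ω = ⨆ K : ℕ, min (T ω) K := by
    intro ω
    rw [← inf_iSup_eq, ENNReal.iSup_natCast, inf_top_eq]
  calc ∫⁻ ω, T ω ∂μ = ∫⁻ ω, ⨆ K : ℕ, min (T ω) K ∂μ := lintegral_congr hsup
    _ = ⨆ K : ℕ, ∫⁻ ω, min (T ω) K ∂μ :=
        lintegral_iSup (fun K => hT.min measurable_const) fun a b hab ω =>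
          min_le_min_left _ (Nat.cast_le.2 hab)
    _ ≤ ENNReal.ofReal (2 * R / ε) := iSup_le htrunc

end ContinuousTime

/-! ### Numerical constants and the two protocols. -/

section Bounds

lemma div_le_stabilization_bound {N D : ℝ} (hN : 0 < N) (hD : 0 < D) :
    2 * (N ^ 3 / 2) / (8 * D * N) ≤
      (Real.pi ^ 2 / 8 - 1 - 1 / 9 + 1 / 27) * (N ^ 2 / D) := by
  have h : 2 * (N ^ 3 / 2) / (8 * D * N) = 1 / 8 * (N ^ 2 / D) := by
    field_simp
  rw [h]
  -- The constant exceeds 1/8 as soon as π² ≥ 9 + 16/27, and π > 3.14 is enough.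
  have hpi := Real.pi_gt_d2
  refine mul_le_mul_of_nonneg_right ?_ (by positivity)
  nlinarith

lemma one_add_sign_eq_zero {N : ℕ} {c : Config N} (hc : Odd c.card) (a : ℝ) :
    a * (1 + sign c) = 0 := by
  rw [sign, hc.neg_one_pow]
  ring

variable {N : ℕ} [NeZero N] {Ω : Type*} [MeasurableSpace Ω] {μ : MeasureTheory.Measure Ω}
  [MeasureTheory.IsProbabilityMeasure μ]

theorem IsSyncRun.measurable_and_lintegral_le (hN : Odd N) {c₀ : Config N} (hc₀ : Odd c₀.card)
    {r : ℝ} (hr : 0 < r) (hr' : r < 1) {X : ℕ → Ω → Config N} (hX : IsSyncRun μ r c₀ X) :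
    Measurable (syncTime X) ∧ ∫⁻ ω, syncTime X ω ∂μ ≤
      ENNReal.ofReal (2 * ((N : ℝ) ^ 3 / 2) / (8 * (r * (1 - r)) * N)) := by
  have hD : 0 < r * (1 - r) := mul_pos hr (sub_pos.2 hr')
  have hN0 : (0 : ℝ) < N := Nat.cast_pos.2 (NeZero.pos N)
  refine IsMarkovChain.lintegral_hittingTime_le (h := potential) hX {c | Legitimate c}
    (by positivity) (abs_potential_le hN)
    (syncMatrix_mulVec_one_add_sign r (4 * (r * (1 - r)) * N)) (one_add_sign_eq_zero hc₀ _) ?_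
  intro c
  rw [syncMatrix_mulVec_potential, add_sub_cancel_left]
  exact drift_lower_bound hD c

theorem IsAsyncRun.measurable_and_lintegral_le (hN : Odd N) {c₀ : Config N} (hc₀ : Odd c₀.card)
    {lam : ℝ} (hlam : 0 < lam) {X : ℝ≥0 → Ω → Config N} (hX : IsAsyncRun μ lam c₀ X) :
    Measurable (asyncTime X) ∧ ∫⁻ ω, asyncTime X ω ∂μ ≤
      ENNReal.ofReal (2 * ((N : ℝ) ^ 3 / 2) / (8 * lam * N)) := by
  have hN0 : (0 : ℝ) < N := Nat.cast_pos.2 (NeZero.pos N)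
  refine ⟨IsContinuousTimeMarkovChain.measurable_hittingTime hX {c | Legitimate c},
    IsContinuousTimeMarkovChain.lintegral_hittingTime_le (h := potential) hX {c | Legitimate c}
      (by positivity) (abs_potential_le hN)
      (asyncGenerator_mulVec_one_add_sign lam (4 * lam * N)) (one_add_sign_eq_zero hc₀ _) ?_⟩
  intro c
  rw [asyncGenerator_mulVec_potential]
  exact drift_lower_bound hlam c

end Bounds

end Herman

theorem mainTheorem1 {N : ℕ} [NeZero N] (hN : Odd N)
    (c₀ : Herman.Config N) (hc₀ : Odd c₀.card)
    {Ω : Type*} [MeasurableSpace Ω] (μ : MeasureTheory.Measure Ω)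
    [MeasureTheory.IsProbabilityMeasure μ] :
    (∀ (r : ℝ) (X : ℕ → Ω → Herman.Config N), 0 < r → r < 1 → Herman.IsSyncRun μ r c₀ X →
      Measurable (Herman.syncTime X) ∧
      ∫⁻ ω, Herman.syncTime X ω ∂μ ≤
        ENNReal.ofReal ((Real.pi ^ 2 / 8 - 1 - 1 / 9 + 1 / 27) * ((N : ℝ) ^ 2 / (r * (1 - r))))) ∧
    (∀ X : ℕ → Ω → Herman.Config N, Herman.IsSyncRun μ (1 / 2) c₀ X →
      ∫⁻ ω, Herman.syncTime X ω ∂μ ≤ ENNReal.ofReal (0.64 * (N : ℝ) ^ 2)) ∧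
    (∀ (lam : ℝ) (X : ℝ≥0 → Ω → Herman.Config N), 0 < lam → Herman.IsAsyncRun μ lam c₀ X →
      Measurable (Herman.asyncTime X) ∧
      ∫⁻ ω, Herman.asyncTime X ω ∂μ ≤
        ENNReal.ofReal ((Real.pi ^ 2 / 8 - 1 - 1 / 9 + 1 / 27) * ((N : ℝ) ^ 2 / lam))) := by
  have hN0 : (0 : ℝ) < N := Nat.cast_pos.2 (NeZero.pos N)
  refine ⟨fun r X hr hr' hX => ?_, fun X hX => ?_, fun lam X hlam hX => ?_⟩
  · obtain ⟨h1, h2⟩ := hX.measurable_and_lintegral_le hN hc₀ hr hr'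
    exact ⟨h1, h2.trans (ENNReal.ofReal_le_ofReal
      (Herman.div_le_stabilization_bound hN0 (mul_pos hr (sub_pos.2 hr'))))⟩
  · refine (hX.measurable_and_lintegral_le hN hc₀ one_half_pos one_half_lt_one).2.trans
      (ENNReal.ofReal_le_ofReal ?_)
    -- With D = 1/4 the bound N²/(8D) is N²/2, already below 0.64 N².
    have h : 2 * ((N : ℝ) ^ 3 / 2) / (8 * (1 / 2 * (1 - 1 / 2)) * N) = 1 / 2 * (N : ℝ) ^ 2 := by
      field_simp
      norm_num
    rw [h]
    gcongr
    norm_num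
  · obtain ⟨h1, h2⟩ := hX.measurable_and_lintegral_le hN hc₀ hlam
    exact ⟨h1, h2.trans (ENNReal.ofReal_le_ofReal
      (Herman.div_le_stabilization_bound hN0 hlam))⟩
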